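/- Let $Z\subset\mathbb R^m$ be an irreducible non-singular real algebraic set, and let $M$ be a connected component of $Z$ (for the Euclidean topology) whose dimension $d$ is maximal among the dimensions of the connected components of $Z$. Suppose that there exist an irreducible real algebraic set $Y\subset\mathbb R^p$ of dimension $d$ and a rational map $\varphi=(\varphi_1,\dots,\varphi_m):\mathbb R^p\dashrightarrow\mathbb R^m$, $\varphi_i\in\mathbb R(x_1,\dots,x_p)$, such that $\varphi$ restricts to a bijection from $Y\cap\operatorname{dom}(\varphi)$ onto $M$, where $\operatorname{dom}(\varphi)$ is the set of points at which every $\varphi_i$ is defined (in particular, this holds if $\varphi$ is defined at every point of $Y$ and $\varphi|_Y:Y\to M$ is bijective). Then $M$ is the only connected component of $Z$ of dimension $d$. Here an algebraic set is irreducible if it is non-empty and not the union of two proper algebraic subsets; the dimension of $S\subset\mathbb R^n$ is the Krull dimension of $\mathbb R[x_1,\dots,x_n]/I(S)$, where $I(S)$ is the ideal of polynomials vanishing on $S$; $Z$ is non-singular if at each $x\in Z$ the gradients $\nabla P(x)$, $P\in I(Z)$, span a space of dimension $m-\dim Z$; and a rational function is defined at $x$ if it can be written as $a/b$ with polynomials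 $a,b$ and $b(x)\neq0$. -/

import Mathlib

namespace RealAlg

open MvPolynomial

/-- Real algebraic subsets of `ℝⁿ`: common zero sets of ideals of real polynomials. -/
def IsAlgebraicSet {n : ℕ} (V : Set (Fin n → ℝ)) : Prop :=
  ∃ I : Ideal (MvPolynomial (Fin n) ℝ), V = zeroLocus ℝ I

/-- An irreducible algebraic set: non-empty, and not the union of two proper algebraic subsets. -/
structure IsIrreducibleAlgebraicSet {n : ℕ} (V : Set (Fin n → ℝ)) : Prop where
  isAlgebraic : IsAlgebraicSet V
  nonempty : V.Nonempty
  eq_or_eq_of_union : ∀ A B : Set (Fin n → ℝ),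
    IsAlgebraicSet A → IsAlgebraicSet B → V = A ∪ B → V = A ∨ V = B

/-- The dimension of a (semialgebraic) subset `S` of `ℝⁿ`: the Krull dimension of the ring
`ℝ[x₁, …, xₙ] / I(S)` of polynomial functions on `S`. -/
noncomputable def dim {n : ℕ} (S : Set (Fin n → ℝ)) : WithBot ℕ∞ :=
  ringKrullDim (MvPolynomial (Fin n) ℝ ⧸ vanishingIdeal ℝ S)

/-- The gradient of a polynomial at a point. -/
noncomputable def gradientAt {n : ℕ} (x : Fin n → ℝ) (P : MvPolynomial (Fin n) ℝ) : Fin n → ℝ :=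
  fun i => eval x (pderiv i P)

/-- The rank at `x` of the Jacobian matrix of (any system of generators of) the ideal `I(V)`:
the dimension of the space spanned by the gradients at `x` of the polynomials in `I(V)`. -/
noncomputable def jacobianRank {n : ℕ} (V : Set (Fin n → ℝ)) (x : Fin n → ℝ) : ℕ :=
  Module.finrank ℝ
    (Submodule.span ℝ (gradientAt x '' (vanishingIdeal ℝ V : Set (MvPolynomial (Fin n) ℝ))))

/-- `V ⊆ ℝⁿ` is non-singular: at each of its points the Jacobian rank is `n - dim V`. -/
def IsNonsingular {n : ℕ} (V : Set (Fin n → ℝ)) : Prop :=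
  ∀ x ∈ V, (jacobianRank V x : WithBot ℕ∞) + dim V = (n : WithBot ℕ∞)

/-- `M` is a connected component of `Z` for the Euclidean topology. -/
def IsConnectedComponentOf {n : ℕ} (M Z : Set (Fin n → ℝ)) : Prop :=
  ∃ x ∈ Z, M = connectedComponentIn Z x

/-- The field `ℝ(x₁, …, xₚ)` of rational functions. -/
abbrev RationalFunction (p : ℕ) : Type := FractionRing (MvPolynomial (Fin p) ℝ)

/-- `a / b` is a representation of `f` whose denominator does not vanish at `x`. -/
def IsRepresentationAt {p : ℕ} (f : RationalFunction p) (x : Fin p → ℝ)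
    (ab : MvPolynomial (Fin p) ℝ × MvPolynomial (Fin p) ℝ) : Prop :=
  eval x ab.2 ≠ 0 ∧
    f = algebraMap _ (RationalFunction p) ab.1 / algebraMap _ (RationalFunction p) ab.2

/-- The rational function `f` is defined at `x`. -/
def IsDefinedAt {p : ℕ} (f : RationalFunction p) (x : Fin p → ℝ) : Prop :=
  ∃ ab, IsRepresentationAt f x ab

open Classical in
/-- The value of a rational function at a point where it is defined (and `0` elsewhere). -/
noncomputable def value {p : ℕ} (f : RationalFunction p) (x : Fin p → ℝ) : ℝ :=
  if h : IsDefinedAt f x then eval x h.choose.1 / eval x h.choose.2 else 0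

/-- The value does not depend on the representation. -/
theorem value_eq {p : ℕ} {f : RationalFunction p} {x : Fin p → ℝ}
    {ab : MvPolynomial (Fin p) ℝ × MvPolynomial (Fin p) ℝ} (h : IsRepresentationAt f x ab) :
    value f x = eval x ab.1 / eval x ab.2 := by
  have hd : IsDefinedAt f x := ⟨ab, h⟩
  rw [value, dif_pos hd]
  have h' := hd.choose_spec
  generalize hd.choose = cd at h' ⊢
  obtain ⟨hb, hf⟩ := h
  obtain ⟨hc, hf'⟩ := h'
  have inj := IsFractionRing.injective (MvPolynomial (Fin p) ℝ) (RationalFunction p)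
  have key : ∀ q : MvPolynomial (Fin p) ℝ, eval x q ≠ 0 →
      algebraMap _ (RationalFunction p) q ≠ 0 := by
    intro q hq h0
    have : q = 0 := inj (by rw [h0, map_zero])
    exact hq (by rw [this, map_zero])
  rw [hf, div_eq_div_iff (key _ hb) (key _ hc), ← map_mul, ← map_mul] at hf'
  have h2 := congrArg (eval x) (inj hf')
  rw [map_mul, map_mul] at h2
  rw [div_eq_div_iff hc hb, h2]

/-- A rational map `ℝᵖ ⇢ ℝᵐ`: an `m`-tuple of rational functions on `ℝᵖ`. -/
abbrev RationalMap (p m : ℕ) : Type := Fin m → RationalFunction p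

/-- The domain of a rational map: the points at which all its components are defined. -/
def RationalMap.domain {p m : ℕ} (φ : RationalMap p m) : Set (Fin p → ℝ) :=
  {x | ∀ i, IsDefinedAt (φ i) x}

/-- The map that a rational map defines on its domain. -/
noncomputable def RationalMap.toFun {p m : ℕ} (φ : RationalMap p m) (x : Fin p → ℝ) :
    Fin m → ℝ :=
  fun i => value (φ i) x

end RealAlg

/-! Let `B` be an algebraic extension of finite type of a domain `A` of characteristic zero. Away
from the zeros of some nonzero `h : A`, the ring `B` is `A[T] / (G)` for a separable monic `G`, so
the points of `B` over a real point `ζ` of `A` are the real roots of `G` specialized at `ζ`.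
Non-real roots come in pairs, hence the number of these points has the same parity as `deg G`: the
generic fibres of a dominant rational map `Y ⇢ Z` between irreducible algebraic sets of the same
dimension all have the same parity. If the map is injective, this parity is odd, and so its image
meets every Zariski dense subset of `Z`.

Some connected component of `Z` is Zariski dense: apply the description above to a Noether
normalization of the coordinate ring of `Z` and continue a simple root of `G` over a ball by the
implicit function theorem. So a component of maximal dimension has the dimension of `Z`, and then it
is itself Zariski dense because `Z` is irreducible. -/

namespace RealAlg

section GenericPrimitive

open Polynomial

/-- `θ` is a root of the monic polynomial `G` over `A`, and after inverting `h` the algebra `B`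
becomes `A[T] / (G)` and is étale over `A`. -/
structure IsGenericPrimitive {A B : Type*} [CommRing A] [CommRing B] [Algebra A B]
    (h : A) (G : A[X]) (θ : B) : Prop where
  monic : G.Monic
  aeval_eq_zero_iff : ∀ Q : A[X], aeval θ Q = 0 ↔ G ∣ Q
  exists_bezout : ∃ U V : A[X], U * G + V * derivative G = C h
  exists_pow_smul_eq_aeval : ∀ b : B, ∃ (k : ℕ) (Q : A[X]), h ^ k • b = aeval θ Q

theorem finiteDimensional_of_isFractionRing (A B K L : Type*) [CommRing A] [IsDomain A]
    [CommRing B] [IsDomain B] [Algebra A B] [Field K] [Field L] [Algebra A K] [IsFractionRing A K]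
    [Algebra B L] [IsFractionRing B L] [Algebra K L] [Algebra A L] [IsScalarTower A B L]
    [IsScalarTower A K L] [Algebra.IsAlgebraic A B] [Algebra.FiniteType A B] :
    FiniteDimensional K L := by
  have : Algebra.IsAlgebraic B L := IsLocalization.isAlgebraic L (nonZeroDivisors B)
  have : Algebra.IsAlgebraic A L := Algebra.IsAlgebraic.trans A B L
  have : Algebra.IsAlgebraic K L := (IsFractionRing.comap_isAlgebraic_iff (A := A)).mp this
  have : Algebra.EssFiniteType B L := .of_isLocalization _ (nonZeroDivisors B)
  have : Algebra.EssFiniteType A L := .comp A B L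
  have : Algebra.EssFiniteType K L := .of_comp A K L
  exact Algebra.finite_of_essFiniteType_of_isAlgebraic

theorem exists_smul_eq_algebraMap (A B : Type*) {L : Type*} [CommRing A] [CommRing B] [IsDomain B]
    [Algebra A B] [Algebra.IsAlgebraic A B] [Field L] [Algebra A L] [Algebra B L]
    [IsScalarTower A B L] [IsFractionRing B L] (x : L) :
    ∃ (a : A) (b : B), a ≠ 0 ∧ a • x = algebraMap B L b := by
  obtain ⟨u, v, hv, rfl⟩ := IsFractionRing.div_surjective (A := B) x
  have hv0 : v ≠ 0 := nonZeroDivisors.ne_zero hv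
  obtain ⟨b, a, ha, hab⟩ := Algebra.IsAlgebraic.exists_smul_eq_mul A u hv0
  have hvL : algebraMap B L v ≠ 0 := by simpa using hv0
  refine ⟨a, b, ha, ?_⟩
  rw [← mul_div_cancel_left₀ (algebraMap B L b) hvL, ← map_mul, ← hab, ← smul_div_assoc]
  exact congrArg (· / _) (algebraMap.coe_smul a u L).symm

theorem exists_monic_map_eq_minpoly_smul (A : Type*) {K L : Type*} [CommRing A] [IsDomain A]
    [Field K] [Field L] [Algebra A K] [IsFractionRing A K] [Algebra K L] {x : L}
    (hx : IsIntegral K x) :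
    ∃ (a : A) (G : A[X]), a ≠ 0 ∧ G.Monic ∧
      G.map (algebraMap A K) = minpoly K (algebraMap A K a • x) := by
  set P := minpoly K x
  set a := IsLocalization.commonDenom (nonZeroDivisors A) P.support P.coeff
  have ha : (a : A) ≠ 0 := nonZeroDivisors.ne_zero a.2
  have hlift : P.scaleRoots (algebraMap A K a) ∈ lifts (algebraMap A K) :=
    IsLocalization.scaleRoots_commonDenom_mem_lifts _ P (by simp [P, minpoly.monic hx])
  obtain ⟨G, hG, -, hmonic⟩ := lifts_and_natDegree_eq_and_monic hlift
    ((monic_scaleRoots_iff _).mpr (minpoly.monic hx))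
  exact ⟨a, G, ha, hmonic, hG.trans (IsIntegrallyClosed.minpoly_smul (by simp [ha]) hx).symm⟩

theorem exists_adjoin_eq_top_of_monic (A B K L : Type*) [CommRing A] [IsDomain A]
    [CommRing B] [IsDomain B] [Algebra A B] [Algebra.IsAlgebraic A B] [Field K] [Field L]
    [Algebra A K] [IsFractionRing A K] [Algebra B L] [IsFractionRing B L] [Algebra K L]
    [Algebra A L] [IsScalarTower A B L] [IsScalarTower A K L] [FiniteDimensional K L]
    [Algebra.IsSeparable K L] :
    ∃ (θ : B) (G : A[X]), G.Monic ∧ G.map (algebraMap A K) = minpoly K (algebraMap B L θ) ∧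
      Algebra.adjoin K {algebraMap B L θ} = ⊤ := by
  obtain ⟨α, hα⟩ := Field.exists_primitive_element K L
  obtain ⟨a, b, ha, hb⟩ := exists_smul_eq_algebraMap A B α
  obtain ⟨c, G, hc, hmonic, hG⟩ :=
    exists_monic_map_eq_minpoly_smul A (Algebra.IsIntegral.isIntegral (R := K) (algebraMap B L b))
  have hcb : algebraMap B L (c • b) = c • algebraMap B L b := algebraMap.coe_smul c b L
  have hθ : algebraMap B L (c • b) = algebraMap A K (c * a) • α := by
    rw [algebraMap_smul, mul_smul, hb, hcb]
  refine ⟨c • b, G, hmonic, by rw [hG, algebraMap_smul, hcb], ?_⟩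
  have hαmem : α ∈ Algebra.adjoin K {algebraMap B L (c • b)} := by
    rw [← inv_smul_smul₀ (show algebraMap A K (c * a) ≠ 0 by simp [ha, hc]) α, ← hθ]
    exact Subalgebra.smul_mem _ (Algebra.self_mem_adjoin_singleton K _) _
  rw [eq_top_iff, ← IntermediateField.top_toSubalgebra, ← hα,
    IntermediateField.adjoin_simple_toSubalgebra_of_isAlgebraic (IsAlgebraic.of_finite K _)]
  exact Algebra.adjoin_le (Set.singleton_subset_iff.mpr hαmem)

theorem exists_map_eq_C_mul (A : Type*) {K : Type*} [CommRing A] [IsDomain A] [Field K]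
    [Algebra A K] [IsFractionRing A K] (q : K[X]) :
    ∃ (a : A) (Q : A[X]), a ≠ 0 ∧ Q.map (algebraMap A K) = C (algebraMap A K a) * q := by
  obtain ⟨b, hb, h⟩ := IsLocalization.integerNormalization_spec (nonZeroDivisors A) q
  refine ⟨b, IsLocalization.integerNormalization (nonZeroDivisors A) q,
    nonZeroDivisors.ne_zero hb, ?_⟩
  rw [h, ← algebraMap_smul K b q, smul_eq_C_mul]

theorem exists_bezout_of_separable_map {A K : Type*} [CommRing A] [IsDomain A] [Field K]
    [Algebra A K] [IsFractionRing A K] {G : A[X]} (hG : (G.map (algebraMap A K)).Separable) :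
    ∃ (c : A) (U V : A[X]), c ≠ 0 ∧ U * G + V * derivative G = C c := by
  obtain ⟨u, v, huv⟩ := hG
  obtain ⟨a, U, ha, hU⟩ := exists_map_eq_C_mul A u
  obtain ⟨b, V, hb, hV⟩ := exists_map_eq_C_mul A v
  refine ⟨a * b, C b * U, C a * V, mul_ne_zero ha hb, ?_⟩
  apply Polynomial.map_injective _ (IsFractionRing.injective A K)
  simp only [Polynomial.map_add, Polynomial.map_mul, ← derivative_map, hU, hV, map_C, map_mul]
  linear_combination C (algebraMap A K a) * C (algebraMap A K b) * huv

section Equation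

variable {A B K L : Type*} [CommRing A] [CommRing B] [Algebra A B] [Field K] [Field L]
  [Algebra A K] [IsFractionRing A K] [Algebra B L] [IsFractionRing B L] [Algebra K L]
  [Algebra A L] [IsScalarTower A B L] [IsScalarTower A K L] {θ : B}

theorem aeval_eq_zero_iff_dvd {G : A[X]} (hmonic : G.Monic)
    (hG : G.map (algebraMap A K) = minpoly K (algebraMap B L θ)) (Q : A[X]) :
    aeval θ Q = 0 ↔ G ∣ Q := by
  rw [← map_dvd_map _ (IsFractionRing.injective A K) hmonic, hG, minpoly.dvd_iff,
    aeval_map_algebraMap, aeval_algebraMap_apply,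
    map_eq_zero_iff _ (IsFractionRing.injective B L)]

theorem exists_smul_eq_aeval [IsDomain A] (hθ : Algebra.adjoin K {algebraMap B L θ} = ⊤) (b : B) :
    ∃ (r : A) (Q : A[X]), r ≠ 0 ∧ r • b = aeval θ Q := by
  obtain ⟨q, hq⟩ : ∃ q : K[X], aeval (algebraMap B L θ) q = algebraMap B L b := by
    rw [← AlgHom.mem_range, ← Algebra.adjoin_singleton_eq_range_aeval K, hθ]
    trivial
  obtain ⟨r, Q, hr, hQ⟩ := exists_map_eq_C_mul A q
  refine ⟨r, Q, hr, IsFractionRing.injective B L ?_⟩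
  rw [← aeval_algebraMap_apply, ← aeval_map_algebraMap K, hQ, map_mul, aeval_C, hq,
    ← Algebra.smul_def, algebraMap_smul]
  exact algebraMap.coe_smul r b L

end Equation

open Pointwise in
theorem exists_forall_pow_smul_mem {A B : Type*} [CommRing A] [IsDomain A] [CommRing B]
    [Algebra A B] [Algebra.FiniteType A B] (S : Subalgebra A B)
    (hS : ∀ b : B, ∃ r : A, r ≠ 0 ∧ r • b ∈ S) :
    ∃ r : A, r ≠ 0 ∧ ∀ b : B, ∃ k : ℕ, r ^ k • b ∈ S := by
  classical
  obtain ⟨s, hs⟩ := ‹Algebra.FiniteType A B›.out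
  choose r hr hrS using hS
  have hsub : (∏ x ∈ s, r x) • (s : Set B) ⊆ S := by
    rintro _ ⟨x, hx, rfl⟩
    change (∏ x ∈ s, r x) • x ∈ S
    rw [← Finset.prod_erase_mul _ _ hx, mul_smul]
    exact S.smul_mem (hrS x) _
  refine ⟨∏ x ∈ s, r x, Finset.prod_ne_zero_iff.mpr fun x _ => hr x, fun b => ?_⟩
  obtain ⟨k, hk⟩ := Algebra.pow_smul_mem_of_smul_subset_of_mem_adjoin _ _ S hsub
    (show b ∈ Algebra.adjoin A (s : Set B) by rw [hs]; trivial) (S.algebraMap_mem _)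
  exact ⟨k, hk k le_rfl⟩

theorem exists_isGenericPrimitive (A B : Type*) [CommRing A] [IsDomain A] [CommRing B] [IsDomain B]
    [Algebra A B] [FaithfulSMul A B] [Algebra.IsAlgebraic A B] [Algebra.FiniteType A B]
    [CharZero A] :
    ∃ (h : A) (G : A[X]) (θ : B), h ≠ 0 ∧ IsGenericPrimitive h G θ := by
  let K := FractionRing A
  let L := FractionRing B
  let := FractionRing.liftAlgebra A L
  have := FractionRing.isScalarTower_liftAlgebra A L
  have : FiniteDimensional K L := finiteDimensional_of_isFractionRing A B K L
  obtain ⟨θ, G, hmonic, hG, hθ⟩ := exists_adjoin_eq_top_of_monic A B K L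
  have hsep : (G.map (algebraMap A K)).Separable := hG ▸ Algebra.IsSeparable.isSeparable K _
  obtain ⟨c, U, V, hc, hUV⟩ := exists_bezout_of_separable_map hsep
  obtain ⟨r, hr, hgen⟩ := exists_forall_pow_smul_mem (aeval (R := A) θ).range fun b => by
    obtain ⟨r, Q, hr, hQ⟩ := exists_smul_eq_aeval (A := A) hθ b
    exact ⟨r, hr, Q, hQ.symm⟩
  refine ⟨r * c, G, θ, mul_ne_zero hr hc, hmonic, aeval_eq_zero_iff_dvd hmonic hG,
    ⟨C r * U, C r * V, by rw [mul_assoc, mul_assoc, ← mul_add, hUV, ← C_mul]⟩, fun b => ?_⟩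
  obtain ⟨k, Q, hQ⟩ := hgen b
  exact ⟨k, C (c ^ k) * Q, by
    rw [mul_pow, mul_comm, mul_smul, ← hQ, map_mul, aeval_C, Algebra.smul_def]; rfl⟩

theorem existsUnique_comp_eq_of_bijective_awayMap {C B F : Type*} [CommRing C] [CommRing B]
    [CommRing F] {j : C →+* B} {h : C} (hj : Function.Bijective (Localization.awayMap j h))
    {γ : C →+* F} (hγ : IsUnit (γ h)) : ∃! β : B →+* F, β.comp j = γ := by
  let e := RingEquiv.ofBijective _ hj
  have he (c : C) : e (algebraMap C (Localization.Away h) c) =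
      algebraMap B (Localization.Away (j h)) (j c) := by
    simp [e, Localization.awayMap, IsLocalization.Away.map]
  refine ⟨(IsLocalization.Away.lift h hγ).comp
    (e.symm.toRingHom.comp (algebraMap B (Localization.Away (j h)))), ?_, fun β hβ => ?_⟩
  · ext c
    simp [← he]
  · ext b
    obtain ⟨c, k, hc⟩ := Localization.awayMap_surjective_iff.mp hj.surjective b
    have hγc (c : C) : β (j c) = γ c := DFunLike.congr_fun hβ c
    have hb : algebraMap C _ c = algebraMap C _ h ^ k * e.symm (algebraMap B _ b) :=
      e.injective (by simp [he, hc])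
    refine (hγ.pow k).mul_left_cancel ?_
    have hlift (c : C) :
        IsLocalization.Away.lift h hγ (algebraMap C (Localization.Away h) c) = γ c :=
      IsLocalization.Away.lift_eq h hγ c
    calc γ h ^ k * β b = γ c := by rw [← hγc, ← hγc, hc, map_mul, map_pow]
      _ = γ h ^ k * IsLocalization.Away.lift h hγ (e.symm (algebraMap B _ b)) := by
        rw [← hlift c, hb, map_mul, map_pow, hlift]

namespace IsGenericPrimitive

variable {A B F : Type*} [CommRing A] [CommRing B] [Algebra A B] [Field F] {h : A} {G : A[X]}
  {θ : B} {ζ : A →+* F}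

theorem separable_map (H : IsGenericPrimitive h G θ) (hζ : ζ h ≠ 0) : (G.map ζ).Separable := by
  obtain ⟨U, V, hUV⟩ := H.exists_bezout
  have hmap := congrArg (Polynomial.map ζ) hUV
  simp only [Polynomial.map_add, Polynomial.map_mul, map_C, ← derivative_map] at hmap
  refine ⟨C (ζ h)⁻¹ * U.map ζ, C (ζ h)⁻¹ * V.map ζ, ?_⟩
  rw [mul_assoc, mul_assoc, ← mul_add, hmap, ← C_mul, inv_mul_cancel₀ hζ, C_1]

theorem eval₂_eq_zero (H : IsGenericPrimitive h G θ) (β : B →+* F) :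
    G.eval₂ (β.comp (algebraMap A B)) (β θ) = 0 := by
  rw [← hom_eval₂, ← aeval_def, (H.aeval_eq_zero_iff G).mpr dvd_rfl, map_zero]

theorem bijective_awayMap_lift (H : IsGenericPrimitive h G θ)
    (hθ : G.eval₂ (algebraMap A B) θ = 0) :
    Function.Bijective
      (Localization.awayMap (AdjoinRoot.lift (algebraMap A B) θ hθ) (AdjoinRoot.of G h)) := by
  refine ⟨Localization.awayMap_injective_iff.mpr fun c hc => ⟨0, ?_⟩,
    Localization.awayMap_surjective_iff.mpr fun b => ?_⟩
  · obtain ⟨Q, rfl⟩ := AdjoinRoot.mk_surjective c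
    rw [AdjoinRoot.lift_mk] at hc
    rw [AdjoinRoot.mk_eq_zero.mpr ((H.aeval_eq_zero_iff Q).mp hc), mul_zero]
  · obtain ⟨k, Q, hQ⟩ := H.exists_pow_smul_eq_aeval b
    refine ⟨AdjoinRoot.mk G Q, k, ?_⟩
    rw [AdjoinRoot.lift_mk, AdjoinRoot.lift_of, ← map_pow, ← Algebra.smul_def, hQ, aeval_def]

theorem existsUnique_of_eval₂_eq_zero (H : IsGenericPrimitive h G θ) (hζ : ζ h ≠ 0) {t : F}
    (ht : G.eval₂ ζ t = 0) : ∃! β : B →+* F, β.comp (algebraMap A B) = ζ ∧ β θ = t := by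
  have hθ : G.eval₂ (algebraMap A B) θ = 0 := (H.aeval_eq_zero_iff G).mpr dvd_rfl
  have hiff (β : B →+* F) : β.comp (algebraMap A B) = ζ ∧ β θ = t ↔
      β.comp (AdjoinRoot.lift (algebraMap A B) θ hθ) = AdjoinRoot.lift ζ t ht := by
    refine ⟨fun hβ => AdjoinRoot.ringHom_ext ?_ ?_, fun hβ => ⟨?_, ?_⟩⟩
    · rw [RingHom.comp_assoc, AdjoinRoot.lift_comp_of, AdjoinRoot.lift_comp_of, hβ.1]
    · simpa using hβ.2
    · simpa [RingHom.comp_assoc] using congrArg (·.comp (AdjoinRoot.of G)) hβ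
    · simpa using DFunLike.congr_fun hβ (AdjoinRoot.root G)
  simp_rw [hiff]
  exact existsUnique_comp_eq_of_bijective_awayMap (H.bijective_awayMap_lift hθ)
    (by simpa using hζ)

theorem bijOn_setOf_isRoot (H : IsGenericPrimitive h G θ) (hζ : ζ h ≠ 0) :
    Set.BijOn (fun β : B →+* F => β θ) {β | β.comp (algebraMap A B) = ζ}
      {t | (G.map ζ).IsRoot t} := by
  have hroot (t : F) : (G.map ζ).IsRoot t ↔ G.eval₂ ζ t = 0 := by rw [IsRoot, eval_map]
  refine ⟨?_, fun β hβ β' hβ' h => ?_, fun t ht => ?_⟩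
  · rintro β rfl
    exact (hroot _).mpr (H.eval₂_eq_zero β)
  · have ht : G.eval₂ ζ (β' θ) = 0 := by
      rw [← show β'.comp (algebraMap A B) = ζ from hβ']
      exact H.eval₂_eq_zero β'
    exact (H.existsUnique_of_eval₂_eq_zero hζ ht).unique ⟨hβ, h⟩ ⟨hβ', rfl⟩
  · exact (H.existsUnique_of_eval₂_eq_zero hζ ((hroot t).mp ht)).exists

end IsGenericPrimitive

theorem card_roots_modEq_natDegree (P : ℝ[X]) : P.roots.card ≡ P.natDegree [MOD 2] := by
  induction P using UniqueFactorizationMonoid.induction_on_prime with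
  | h₁ => rw [roots_zero, natDegree_zero, Multiset.card_zero]
  | h₂ u hu =>
    obtain ⟨c, -, rfl⟩ := isUnit_iff.mp hu
    rw [roots_C, natDegree_C, Multiset.card_zero]
  | h₃ P q hP hq ih =>
    rw [roots_mul (mul_ne_zero hq.ne_zero hP), Multiset.card_add, natDegree_mul hq.ne_zero hP]
    refine Nat.ModEq.add ?_ ih
    obtain hdeg | hdeg := eq_or_ne q.natDegree 1
    · rw [roots_degree_eq_one (degree_eq_iff_natDegree_eq hq.ne_zero |>.mpr hdeg), hdeg,
        Multiset.card_singleton]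
    · have hpos := hq.irreducible.natDegree_pos
      have hle := hq.irreducible.natDegree_le_two
      rw [roots_eq_zero_of_irreducible_of_natDegree_ne_one hq.irreducible hdeg,
        show q.natDegree = 2 by lia, Multiset.card_zero]
      rfl

theorem ncard_setOf_isRoot_modEq_natDegree {P : ℝ[X]} (hP : P.Separable) :
    {t | P.IsRoot t}.ncard ≡ P.natDegree [MOD 2] := by
  have hroots : {t | P.IsRoot t} = P.roots.toFinset := by
    ext t
    simp [hP.ne_zero]
  rw [hroots, Set.ncard_coe_finset, Multiset.toFinset_card_of_nodup (nodup_roots hP)]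
  exact card_roots_modEq_natDegree P

theorem exists_forall_ncard_modEq (A B : Type*) [CommRing A] [IsDomain A] [CommRing B] [IsDomain B]
    [Algebra A B] [FaithfulSMul A B] [Algebra.IsAlgebraic A B] [Algebra.FiniteType A B]
    [CharZero A] :
    ∃ (h : A) (n : ℕ), h ≠ 0 ∧ ∀ ζ : A →+* ℝ, ζ h ≠ 0 →
      {β : B →+* ℝ | β.comp (algebraMap A B) = ζ}.ncard ≡ n [MOD 2] := by
  obtain ⟨h, G, θ, hh, H⟩ := exists_isGenericPrimitive A B
  refine ⟨h, G.natDegree, hh, fun ζ hζ => ?_⟩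
  rw [(H.bijOn_setOf_isRoot hζ).ncard_eq, ← H.monic.natDegree_map ζ]
  exact ncard_setOf_isRoot_modEq_natDegree (H.separable_map hζ)

end GenericPrimitive

section Dimension

theorem ringKrullDim_eq_of_isIntegral (R S : Type*) [CommRing R] [CommRing S] [Algebra R S]
    [Algebra.IsIntegral R S] [FaithfulSMul R S] : ringKrullDim S = ringKrullDim R := by
  apply le_antisymm
  · exact Order.krullDim_le_of_strictMono (PrimeSpectrum.comap (algebraMap R S)) fun I J hIJ =>
      Ideal.IsIntegral.comap_lt_comap (R := R) (I := I.asIdeal) (J := J.asIdeal) hIJ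
  · refine iSup_le fun l => ?_
    obtain ⟨Q, hQ, hover⟩ := Ideal.nonempty_primesOver (S := S) l.head.asIdeal
    obtain ⟨L, hlength, -⟩ := Ideal.exists_ltSeries_of_hasGoingUp l Q
    exact hlength ▸ Order.LTSeries.length_le_krullDim L

theorem trdeg_eq_of_isAlgebraic.{u, v} (k : Type u) (A B : Type v) [Field k] [CommRing A]
    [IsDomain A] [CommRing B] [IsDomain B] [Algebra k A] [Algebra k B] [Algebra A B]
    [IsScalarTower k A B] [FaithfulSMul A B] [Algebra.IsAlgebraic A B] :
    Algebra.trdeg k B = Algebra.trdeg k A := by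
  rw [← trdeg_add_eq k A (A := B), trdeg_eq_zero (R := A), add_zero]

theorem isAlgebraic_of_trdeg_eq.{u, v} {k : Type u} {A B : Type v} [Field k] [CommRing A]
    [IsDomain A] [CommRing B] [IsDomain B] [Algebra k A] [Algebra k B] [Algebra A B]
    [IsScalarTower k A B] [FaithfulSMul A B] {d : ℕ} (hA : Algebra.trdeg k A = d)
    (hB : Algebra.trdeg k B = d) : Algebra.IsAlgebraic A B := by
  have hadd := trdeg_add_eq k A (A := B)
  rw [hA, hB] at hadd
  rw [← trdeg_eq_zero_iff]
  exact Cardinal.eq_of_add_eq_add_left (by rw [hadd, add_zero]) Cardinal.natCast_lt_aleph0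

theorem exists_isIntegral_faithfulSMul_mvPolynomial (k R : Type*) [Field k] [CommRing R]
    [Nontrivial R] [Algebra k R] [Algebra.FiniteType k R] :
    ∃ (s : ℕ) (_ : Algebra (MvPolynomial (Fin s) k) R),
      IsScalarTower k (MvPolynomial (Fin s) k) R ∧ FaithfulSMul (MvPolynomial (Fin s) k) R ∧
      Algebra.IsIntegral (MvPolynomial (Fin s) k) R := by
  obtain ⟨s, g, hinj, hint⟩ := exists_integral_inj_algHom_of_fg k R
  let := g.toRingHom.toAlgebra
  exact ⟨s, this, IsScalarTower.of_algebraMap_eq fun x => (g.commutes x).symm,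
    (faithfulSMul_iff_algebraMap_injective _ _).mpr hinj, ⟨hint⟩⟩

theorem trdeg_eq_of_ringKrullDim_eq (k R : Type*) [Field k] [CommRing R] [IsDomain R] [Algebra k R]
    [Algebra.FiniteType k R] {d : ℕ} (hd : ringKrullDim R = d) : Algebra.trdeg k R = d := by
  obtain ⟨s, _, _, _, _⟩ := exists_isIntegral_faithfulSMul_mvPolynomial k R
  have hdim := ringKrullDim_eq_of_isIntegral (MvPolynomial (Fin s) k) R
  rw [hd, MvPolynomial.ringKrullDim_of_isNoetherianRing, ringKrullDim_eq_zero_of_field,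
    zero_add, Nat.card_fin] at hdim
  have htrdeg := lift_trdeg_add_eq k (MvPolynomial (Fin s) k) R
  rw [trdeg_eq_zero (R := MvPolynomial (Fin s) k) (A := R),
    MvPolynomial.trdeg_of_isDomain] at htrdeg
  simp only [Cardinal.mk_fin, Cardinal.lift_natCast, Cardinal.lift_zero, add_zero] at htrdeg
  rw [show d = s by exact_mod_cast hdim]
  exact Cardinal.lift_eq_nat_iff.mp htrdeg.symm

end Dimension

section CoordRing

open MvPolynomial

variable {n : ℕ}

/-- The ring of polynomial functions on a subset of `ℝⁿ`. -/
abbrev CoordRing (V : Set (Fin n → ℝ)) : Type :=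
  MvPolynomial (Fin n) ℝ ⧸ vanishingIdeal ℝ V

/-- Evaluation of polynomial functions at a point, the homomorphism `P ↦ P(z)`. -/
noncomputable def evalAt {V : Set (Fin n → ℝ)} {z : Fin n → ℝ} (hz : z ∈ V) : CoordRing V →+* ℝ :=
  Ideal.Quotient.lift _ (eval z) fun P hP => by
    simpa [aeval_eq_eval] using (mem_vanishingIdeal_iff.mp hP) z hz

@[simp]
theorem evalAt_mk {V : Set (Fin n → ℝ)} {z : Fin n → ℝ} (hz : z ∈ V)
    (P : MvPolynomial (Fin n) ℝ) :
    evalAt hz (Ideal.Quotient.mk (vanishingIdeal ℝ V) P) = eval z P :=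
  Ideal.Quotient.lift_mk _ _ _

theorem ringHom_eq_eval (β : MvPolynomial (Fin n) ℝ →+* ℝ) : β = eval fun i => β (X i) := by
  refine MvPolynomial.ringHom_ext (fun r => ?_) (fun i => by rw [eval_X])
  rw [eval_C]
  exact RingHom.congr_fun (Subsingleton.elim (β.comp C) (RingHom.id ℝ)) r

theorem exists_evalAt_eq {V : Set (Fin n → ℝ)} (hV : IsAlgebraicSet V) (β : CoordRing V →+* ℝ) :
    ∃ (z : Fin n → ℝ) (hz : z ∈ V), evalAt hz = β := by
  set z : Fin n → ℝ := fun i => β (Ideal.Quotient.mk _ (X i))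
  have hβ (P : MvPolynomial (Fin n) ℝ) : β (Ideal.Quotient.mk _ P) = eval z P :=
    RingHom.congr_fun (ringHom_eq_eval (β.comp (Ideal.Quotient.mk _))) P
  have hz : z ∈ V := by
    obtain ⟨I, hI⟩ := hV
    rw [hI]
    intro P hP
    have hPV : P ∈ vanishingIdeal ℝ V := hI ▸ le_vanishingIdeal_zeroLocus I hP
    rw [aeval_eq_eval, ← hβ, Ideal.Quotient.eq_zero_iff_mem.mpr hPV, map_zero]
  exact ⟨z, hz, Ideal.Quotient.ringHom_ext (RingHom.ext fun P => by simp [hβ])⟩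

theorem exists_evalAt_ne_zero {V W : Set (Fin n → ℝ)} (hWV : W ⊆ V)
    (h : vanishingIdeal ℝ W = vanishingIdeal ℝ V) {a : CoordRing V} (ha : a ≠ 0) :
    ∃ (z : Fin n → ℝ) (hz : z ∈ W), evalAt (hWV hz) a ≠ 0 := by
  obtain ⟨P, rfl⟩ := Ideal.Quotient.mk_surjective a
  by_contra! hvanish
  refine ha (Ideal.Quotient.eq_zero_iff_mem.mpr ?_)
  rw [← h]
  intro z hz
  simpa [aeval_eq_eval] using hvanish z hz

theorem IsAlgebraicSet.inter_zeros {V : Set (Fin n → ℝ)} (hV : IsAlgebraicSet V)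
    (P : MvPolynomial (Fin n) ℝ) : IsAlgebraicSet (V ∩ {x | eval x P = 0}) := by
  obtain ⟨I, rfl⟩ := hV
  refine ⟨I ⊔ Ideal.span {P}, ?_⟩
  have hinter : zeroLocus ℝ (I ⊔ Ideal.span {P}) = zeroLocus ℝ I ∩ zeroLocus ℝ (Ideal.span {P}) :=
    zeroLocus_vanishingIdeal_galoisConnection.l_sup
  rw [hinter, zeroLocus_span]
  simp [aeval_eq_eval]

theorem IsIrreducibleAlgebraicSet.isPrime {V : Set (Fin n → ℝ)}
    (hV : IsIrreducibleAlgebraicSet V) : (vanishingIdeal ℝ V).IsPrime := by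
  refine ⟨(Ideal.ne_top_iff_one _).mpr fun hone => ?_, fun {P Q} hPQ => ?_⟩
  · obtain ⟨z, hz⟩ := hV.nonempty
    simpa using hone z hz
  · have hcover : V = (V ∩ {x | eval x P = 0}) ∪ (V ∩ {x | eval x Q = 0}) := by
      rw [← Set.inter_union_distrib_left, eq_comm, Set.inter_eq_left]
      intro z hz
      simpa [aeval_eq_eval] using hPQ z hz
    refine (hV.eq_or_eq_of_union _ _ (hV.isAlgebraic.inter_zeros P)
      (hV.isAlgebraic.inter_zeros Q) hcover).imp (fun h z hz => ?_) (fun h z hz => ?_)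
    all_goals
      rw [h] at hz
      exact hz.2

theorem dim_mono {V W : Set (Fin n → ℝ)} (h : W ⊆ V) : dim W ≤ dim V :=
  ringKrullDim_le_of_surjective _ (Ideal.Quotient.factor_surjective (vanishingIdeal_anti_mono h))

theorem vanishingIdeal_eq_of_dim_eq {V W : Set (Fin n → ℝ)} {d : ℕ}
    (hV : IsIrreducibleAlgebraicSet V) (h : W ⊆ V) (hWd : dim W = d) (hVd : dim V = d) :
    vanishingIdeal ℝ W = vanishingIdeal ℝ V := by
  have := hV.isPrime
  have hle : vanishingIdeal ℝ V ≤ vanishingIdeal ℝ W := vanishingIdeal_anti_mono h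
  refine le_antisymm (fun P hP => ?_) hle
  by_contra hPV
  have hPne : Ideal.Quotient.mk (vanishingIdeal ℝ V) P ≠ 0 :=
    fun h => hPV (Ideal.Quotient.eq_zero_iff_mem.mp h)
  have hdim : dim W + 1 ≤ dim V := ringKrullDim_succ_le_of_surjective _
    (Ideal.Quotient.factor_surjective hle) (mem_nonZeroDivisors_of_ne_zero hPne)
    (by rw [Ideal.Quotient.factor_mk]; exact Ideal.Quotient.eq_zero_iff_mem.mpr hP)
  rw [hWd, hVd] at hdim
  exact Nat.not_succ_le_self d (by exact_mod_cast hdim)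

end CoordRing

section DenseComponent

open MvPolynomial Topology

variable {n s : ℕ}

theorem contDiff_eval {𝕜 ι : Type*} [NontriviallyNormedField 𝕜] [Fintype ι] {k : WithTop ℕ∞}
    (P : MvPolynomial ι 𝕜) : ContDiff 𝕜 k (fun x : ι → 𝕜 => eval x P) := by
  induction P using MvPolynomial.induction_on with
  | C a => simpa using contDiff_const
  | add p q hp hq => simpa using hp.add hq
  | mul_X p i hp => simpa using hp.mul (contDiff_apply 𝕜 𝕜 i)

theorem contDiff_eval₂ {𝕜 ι : Type*} [NontriviallyNormedField 𝕜] [Fintype ι] {k : WithTop ℕ∞}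
    (Q : Polynomial (MvPolynomial ι 𝕜)) :
    ContDiff 𝕜 k (fun u : (ι → 𝕜) × 𝕜 => Q.eval₂ (eval u.1) u.2) := by
  induction Q using Polynomial.induction_on' with
  | add p q hp hq => simpa using hp.add hq
  | monomial l a => simpa using ((contDiff_eval a).comp contDiff_fst).mul (contDiff_snd.pow l)

theorem exists_eventually_root (G : Polynomial (MvPolynomial (Fin s) ℝ)) {x₀ : Fin s → ℝ} {t₀ : ℝ}
    (hroot : G.eval₂ (eval x₀) t₀ = 0)
    (hsimple : (G.map (eval x₀)).derivative.eval t₀ ≠ 0) :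
    ∃ ψ : (Fin s → ℝ) → ℝ, ∀ᶠ x in 𝓝 x₀, G.eval₂ (eval x) (ψ x) = 0 ∧ ContinuousAt ψ x := by
  set f : (Fin s → ℝ) × ℝ → ℝ := fun u => G.eval₂ (eval u.1) u.2 with hf
  have hfdiff : ContDiffAt ℝ 1 f (x₀, t₀) := (contDiff_eval₂ G).contDiffAt
  have hderiv : HasDerivAt (fun t => f (x₀, t)) ((G.map (eval x₀)).derivative.eval t₀) t₀ := by
    simpa only [hf, Polynomial.eval_map] using (G.map (eval x₀)).hasDerivAt t₀
  have hpartial : HasFDerivAt (fun t => f (x₀, t))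
      (fderiv ℝ f (x₀, t₀) ∘L .inr ℝ (Fin s → ℝ) ℝ) t₀ :=
    (hfdiff.differentiableAt one_ne_zero).hasFDerivAt.comp t₀ (hasFDerivAt_prodMk_right x₀ t₀)
  have hinv : (fderiv ℝ f (x₀, t₀) ∘L .inr ℝ (Fin s → ℝ) ℝ).IsInvertible := by
    rw [hpartial.unique hderiv.hasFDerivAt]
    exact ⟨ContinuousLinearEquiv.unitsEquivAut ℝ (Units.mk0 _ hsimple), by ext; simp⟩
  refine ⟨hfdiff.implicitFunction one_ne_zero hinv, ?_⟩
  filter_upwards [hfdiff.eventually_apply_implicitFunction one_ne_zero hinv,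
    (hfdiff.contDiffAt_implicitFunction one_ne_zero hinv).eventually (by simp)] with x hx hψ
  exact ⟨hx.trans hroot, hψ.continuousAt⟩

theorem exists_mem_ball_eval_ne_zero {a : MvPolynomial (Fin s) ℝ} (ha : a ≠ 0) (x₀ : Fin s → ℝ)
    {ε : ℝ} (hε : 0 < ε) : ∃ x ∈ Metric.ball x₀ ε, eval x a ≠ 0 := by
  by_contra! hvanish
  refine ha (MvPolynomial.funext_set (fun i => Metric.ball (x₀ i) ε) (fun i => ?_) fun x hx => ?_)
  · rw [Real.ball_eq_Ioo]
    exact Set.Ioo_infinite (by linarith)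
  · rw [map_zero]
    exact hvanish x (by rwa [ball_pi x₀ hε])

theorem vanishingIdeal_eq_of_forall_evalAt_ne_zero (A : Type*) {W Z : Set (Fin n → ℝ)} [CommRing A]
    [IsDomain (CoordRing Z)] [Algebra A (CoordRing Z)] [Algebra.IsAlgebraic A (CoordRing Z)]
    (hWZ : W ⊆ Z)
    (h : ∀ a : A, a ≠ 0 →
      ∃ (w : Fin n → ℝ) (hw : w ∈ W), evalAt (hWZ hw) (algebraMap A (CoordRing Z) a) ≠ 0) :
    vanishingIdeal ℝ W = vanishingIdeal ℝ Z := by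
  refine le_antisymm (fun P hP => ?_) (vanishingIdeal_anti_mono hWZ)
  by_contra hPZ
  have hPne : Ideal.Quotient.mk (vanishingIdeal ℝ Z) P ≠ 0 :=
    fun h => hPZ (Ideal.Quotient.eq_zero_iff_mem.mp h)
  obtain ⟨a, ha, c, hc⟩ := (Algebra.IsAlgebraic.isAlgebraic (R := A)
    (Ideal.Quotient.mk (vanishingIdeal ℝ Z) P)).exists_nonzero_dvd
      (mem_nonZeroDivisors_of_ne_zero hPne)
  obtain ⟨w, hw, hne⟩ := h a ha
  have hPw : eval w P = 0 := hP w hw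
  exact hne (by rw [hc, map_mul, evalAt_mk, hPw, zero_mul])

variable {Z : Set (Fin n → ℝ)} [Algebra (MvPolynomial (Fin s) ℝ) (CoordRing Z)]
  {h : MvPolynomial (Fin s) ℝ} {G : Polynomial (MvPolynomial (Fin s) ℝ)} {θ : CoordRing Z}

theorem IsGenericPrimitive.continuousAt_point (H : IsGenericPrimitive h G θ)
    {σ : (Fin s → ℝ) → Fin n → ℝ} {ψ : (Fin s → ℝ) → ℝ} {x₀ : Fin s → ℝ}
    (hσ : ∀ᶠ x in 𝓝 x₀, ∃ hx : σ x ∈ Z,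
      (evalAt hx).comp (algebraMap _ _) = eval x ∧ evalAt hx θ = ψ x)
    (hψ : ContinuousAt ψ x₀) (hh : eval x₀ h ≠ 0) : ContinuousAt σ x₀ := by
  refine continuousAt_pi.mpr fun i => ?_
  obtain ⟨k, Q, hQ⟩ := H.exists_pow_smul_eq_aeval (Ideal.Quotient.mk _ (X i))
  have hh' := h.continuous_eval.continuousAt (x := x₀)
  have hformula : ∀ᶠ x in 𝓝 x₀, Q.eval₂ (eval x) (ψ x) / eval x h ^ k = σ x i := by
    filter_upwards [hσ, hh'.eventually_ne hh] with x ⟨hx, hcomp, hθ⟩ hne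
    rw [div_eq_iff (pow_ne_zero _ hne), ← hcomp, ← hθ, ← Polynomial.hom_eval₂,
      ← Polynomial.aeval_def, ← hQ, Algebra.smul_def, map_mul, map_pow, map_pow, evalAt_mk, eval_X,
      mul_comm, RingHom.comp_apply]
  refine ContinuousAt.congr (ContinuousAt.div ?_ (hh'.pow k) (pow_ne_zero _ hh)) hformula
  exact (contDiff_eval₂ (k := 0) Q).continuous.continuousAt.comp
    (f := fun x => (x, ψ x)) (continuousAt_id.prodMk hψ)

theorem IsGenericPrimitive.exists_local_section (H : IsGenericPrimitive h G θ)
    (hZ : IsAlgebraicSet Z) {x₀ : Fin s → ℝ} {t₀ : ℝ} (hh : eval x₀ h ≠ 0)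
    (ht₀ : G.eval₂ (eval x₀) t₀ = 0) :
    ∃ ε > 0, ∃ σ : (Fin s → ℝ) → Fin n → ℝ, ContinuousOn σ (Metric.ball x₀ ε) ∧
      ∀ x ∈ Metric.ball x₀ ε, ∃ hx : σ x ∈ Z, (evalAt hx).comp (algebraMap _ _) = eval x := by
  have hsimple : (G.map (eval x₀)).derivative.eval t₀ ≠ 0 :=
    (H.separable_map hh).eval₂_derivative_ne_zero (RingHom.id ℝ)
      (by rwa [Polynomial.eval₂_id, Polynomial.eval_map])
  obtain ⟨ψ, hψ⟩ := exists_eventually_root G ht₀ hsimple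
  have hne : ∀ᶠ x in 𝓝 x₀, eval x h ≠ 0 :=
    h.continuous_eval.continuousAt.eventually_ne hh
  obtain ⟨ε, hε, hball⟩ := Metric.eventually_nhds_iff_ball.mp (hψ.and hne)
  have hpoint : ∀ x ∈ Metric.ball x₀ ε, ∃ (z : Fin n → ℝ) (hz : z ∈ Z),
      (evalAt hz).comp (algebraMap _ _) = eval x ∧ evalAt hz θ = ψ x := fun x hx => by
    obtain ⟨⟨hroot, -⟩, hhx⟩ := hball x hx
    obtain ⟨β, hβ, -⟩ := H.existsUnique_of_eval₂_eq_zero hhx hroot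
    obtain ⟨z, hz, rfl⟩ := exists_evalAt_eq hZ β
    exact ⟨z, hz, hβ⟩
  choose! σ hσ using hpoint
  refine ⟨ε, hε, σ, fun x hx => ContinuousAt.continuousWithinAt ?_,
    fun x hx => (hσ x hx).imp fun _ => And.left⟩
  exact H.continuousAt_point (Filter.eventually_of_mem (Metric.isOpen_ball.mem_nhds hx) hσ)
    (hball x hx).1.2 (hball x hx).2

theorem exists_isConnectedComponentOf_of_local_section [IsDomain (CoordRing Z)]
    [Algebra.IsAlgebraic (MvPolynomial (Fin s) ℝ) (CoordRing Z)] {x₀ : Fin s → ℝ} {ε : ℝ}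
    (hε : 0 < ε) {σ : (Fin s → ℝ) → Fin n → ℝ} (hσ : ContinuousOn σ (Metric.ball x₀ ε))
    (hσZ : ∀ x ∈ Metric.ball x₀ ε, ∃ hx : σ x ∈ Z,
      (evalAt hx).comp (algebraMap (MvPolynomial (Fin s) ℝ) (CoordRing Z)) = eval x) :
    ∃ C, IsConnectedComponentOf C Z ∧ vanishingIdeal ℝ C = vanishingIdeal ℝ Z := by
  have hmem := Metric.mem_ball_self hε (x := x₀)
  have himage : σ '' Metric.ball x₀ ε ⊆ connectedComponentIn Z (σ x₀) :=
    ((convex_ball x₀ ε).isPreconnected.image σ hσ).subset_connectedComponentIn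
      (Set.mem_image_of_mem σ hmem) (Set.image_subset_iff.mpr fun x hx => (hσZ x hx).1)
  refine ⟨connectedComponentIn Z (σ x₀), ⟨σ x₀, (hσZ x₀ hmem).1, rfl⟩,
    vanishingIdeal_eq_of_forall_evalAt_ne_zero (MvPolynomial (Fin s) ℝ)
      (connectedComponentIn_subset _ _) fun a ha => ?_⟩
  obtain ⟨x, hx, hax⟩ := exists_mem_ball_eval_ne_zero ha x₀ hε
  obtain ⟨hxZ, hcomp⟩ := hσZ x hx
  exact ⟨σ x, himage (Set.mem_image_of_mem σ hx), by rwa [← RingHom.comp_apply, hcomp]⟩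

theorem exists_isConnectedComponentOf_vanishingIdeal_eq {Z : Set (Fin n → ℝ)}
    (hZ : IsIrreducibleAlgebraicSet Z) :
    ∃ C, IsConnectedComponentOf C Z ∧ vanishingIdeal ℝ C = vanishingIdeal ℝ Z := by
  have := hZ.isPrime
  obtain ⟨s, _, _, _, _⟩ := exists_isIntegral_faithfulSMul_mvPolynomial ℝ (CoordRing Z)
  have : Algebra.FiniteType (MvPolynomial (Fin s) ℝ) (CoordRing Z) :=
    .of_restrictScalars_finiteType ℝ _ _
  obtain ⟨h, G, θ, hh, H⟩ := exists_isGenericPrimitive (MvPolynomial (Fin s) ℝ) (CoordRing Z)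
  have hh' : algebraMap (MvPolynomial (Fin s) ℝ) (CoordRing Z) h ≠ 0 :=
    (map_ne_zero_iff _ (FaithfulSMul.algebraMap_injective _ _)).mpr hh
  obtain ⟨z, hz, hhz⟩ := exists_evalAt_ne_zero subset_rfl rfl hh'
  have hx₀ := ringHom_eq_eval ((evalAt hz).comp (algebraMap (MvPolynomial (Fin s) ℝ) (CoordRing Z)))
  obtain ⟨ε, hε, σ, hσ, hσZ⟩ := H.exists_local_section hZ.isAlgebraic
    (hx₀ ▸ hhz) (hx₀ ▸ H.eval₂_eq_zero (evalAt hz))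
  exact exists_isConnectedComponentOf_of_local_section hε hσ hσZ

end DenseComponent

section RationalMap

open MvPolynomial

variable {m p : ℕ}

/-- The numerator of a rational function in lowest terms. -/
noncomputable abbrev ratNum (f : RationalFunction p) : MvPolynomial (Fin p) ℝ :=
  IsFractionRing.num (MvPolynomial (Fin p) ℝ) f

/-- The denominator of a rational function in lowest terms. -/
noncomputable abbrev ratDen (f : RationalFunction p) : MvPolynomial (Fin p) ℝ :=
  IsFractionRing.den (MvPolynomial (Fin p) ℝ) f

theorem isRepresentationAt_ratNum_ratDen {f : RationalFunction p} {x : Fin p → ℝ}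
    (h : eval x (ratDen f) ≠ 0) : IsRepresentationAt f x (ratNum f, ratDen f) :=
  ⟨h, (IsFractionRing.mk'_num_den' _ f).symm⟩

theorem ratDen_dvd_of_eq_div {f : RationalFunction p} {a b : MvPolynomial (Fin p) ℝ} (hb : b ≠ 0)
    (hf : f = algebraMap _ _ a / algebraMap _ _ b) : ratDen f ∣ b := by
  have inj := IsFractionRing.injective (MvPolynomial (Fin p) ℝ) (RationalFunction p)
  have heq := (IsFractionRing.mk'_num_den' (MvPolynomial (Fin p) ℝ) f).trans hf
  rw [div_eq_div_iff ((map_ne_zero_iff _ inj).mpr (nonZeroDivisors.coe_ne_zero _))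
    ((map_ne_zero_iff _ inj).mpr hb), ← map_mul, ← map_mul] at heq
  exact (IsFractionRing.num_den_reduced _ f).symm.dvd_of_dvd_mul_left
    ⟨a, by rw [inj heq, mul_comm]⟩

theorem isDefinedAt_iff {f : RationalFunction p} {x : Fin p → ℝ} :
    IsDefinedAt f x ↔ eval x (ratDen f) ≠ 0 := by
  refine ⟨?_, fun h => ⟨_, isRepresentationAt_ratNum_ratDen h⟩⟩
  rintro ⟨⟨a, b⟩, hb, hf⟩ hx
  have hdvd : ratDen f ∣ b := ratDen_dvd_of_eq_div (fun h => hb (by rw [h, map_zero])) hf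
  exact hb (zero_dvd_iff.mp (hx ▸ map_dvd (eval x) hdvd))

/-- The product of the reduced denominators of a rational map, non-zero exactly on its domain. -/
noncomputable def commonDen (φ : RationalMap p m) : MvPolynomial (Fin p) ℝ := ∏ i, ratDen (φ i)

theorem mem_domain_iff {φ : RationalMap p m} {x : Fin p → ℝ} :
    x ∈ φ.domain ↔ eval x (commonDen φ) ≠ 0 := by
  rw [commonDen, map_prod, Finset.prod_ne_zero_iff]
  simp [RationalMap.domain, isDefinedAt_iff]

variable {Z : Set (Fin m → ℝ)} {Y : Set (Fin p → ℝ)} {φ : RationalMap p m}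

variable (Y φ) in
/-- The ring of regular functions on the part of `Y` where the rational map is defined, encoded as
the localization of the coordinate ring of `Y` away from the common denominator. -/
abbrev DomainRing : Type :=
  Localization.Away (Ideal.Quotient.mk (vanishingIdeal ℝ Y) (commonDen φ))

/-- Evaluation of regular functions at a point of `Y` in the domain of the rational map. -/
noncomputable def domainEval {y : Fin p → ℝ} (hy : y ∈ Y ∩ φ.domain) : DomainRing Y φ →+* ℝ :=
  IsLocalization.Away.lift (Ideal.Quotient.mk (vanishingIdeal ℝ Y) (commonDen φ))
    (g := evalAt hy.1) (by rw [evalAt_mk]; exact (mem_domain_iff.mp hy.2).isUnit)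

@[simp]
theorem domainEval_algebraMap {y : Fin p → ℝ} (hy : y ∈ Y ∩ φ.domain) (c : CoordRing Y) :
    domainEval hy (algebraMap _ (DomainRing Y φ) c) = evalAt hy.1 c :=
  IsLocalization.Away.lift_eq _ _ c

theorem domainEval_injective {y y' : Fin p → ℝ} (hy : y ∈ Y ∩ φ.domain) (hy' : y' ∈ Y ∩ φ.domain)
    (h : domainEval hy = domainEval hy') : y = y' := by
  ext i
  simpa using RingHom.congr_fun h
    (algebraMap (CoordRing Y) _ (Ideal.Quotient.mk (vanishingIdeal ℝ Y) (X i)))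

theorem exists_domainEval_eq (hY : IsAlgebraicSet Y) (γ : DomainRing Y φ →+* ℝ) :
    ∃ (y : Fin p → ℝ) (hy : y ∈ Y ∩ φ.domain), domainEval hy = γ := by
  obtain ⟨y, hyY, hγ⟩ := exists_evalAt_eq hY (γ.comp (algebraMap (CoordRing Y) (DomainRing Y φ)))
  set g := Ideal.Quotient.mk (vanishingIdeal ℝ Y) (commonDen φ)
  have hunit : IsUnit (algebraMap _ (DomainRing Y φ) g) := IsLocalization.Away.algebraMap_isUnit g
  have hyφ : y ∈ φ.domain := mem_domain_iff.mpr <| by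
    rw [← evalAt_mk hyY, hγ]
    exact (hunit.map γ).ne_zero
  refine ⟨y, ⟨hyY, hyφ⟩, IsLocalization.ringHom_ext (Submonoid.powers g) ?_⟩
  rw [← hγ]
  exact RingHom.ext (domainEval_algebraMap ⟨hyY, hyφ⟩)

theorem eq_zero_of_forall_domainEval_eq_zero {b : DomainRing Y φ}
    (h : ∀ (y : Fin p → ℝ) (hy : y ∈ Y ∩ φ.domain), domainEval hy b = 0) : b = 0 := by
  set g := Ideal.Quotient.mk (vanishingIdeal ℝ Y) (commonDen φ) with hg
  obtain ⟨k, c, hc⟩ := IsLocalization.Away.surj g b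
  have hunit : IsUnit (algebraMap _ (DomainRing Y φ) g) := IsLocalization.Away.algebraMap_isUnit g
  have hcg : c * g = 0 := by
    obtain ⟨P, rfl⟩ := Ideal.Quotient.mk_surjective c
    rw [hg, ← map_mul, Ideal.Quotient.eq_zero_iff_mem]
    intro y hy
    rw [aeval_eq_eval, map_mul, mul_eq_zero, or_iff_not_imp_right, ← ne_eq, ← mem_domain_iff]
    intro hyφ
    have hy' : y ∈ Y ∩ φ.domain := ⟨hy, hyφ⟩
    rw [← evalAt_mk hy, ← domainEval_algebraMap hy', ← hc, map_mul, h y hy', zero_mul]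
  have hc0 : algebraMap _ (DomainRing Y φ) c = 0 := by
    rw [← hunit.mul_left_eq_zero, ← map_mul, hcg, map_zero]
  exact (hunit.pow k).mul_left_eq_zero.mp (hc.trans hc0)

theorem isUnit_algebraMap_ratDen (i : Fin m) : IsUnit (algebraMap (CoordRing Y) (DomainRing Y φ)
    (Ideal.Quotient.mk (vanishingIdeal ℝ Y) (ratDen (φ i)))) :=
  isUnit_of_dvd_unit
    (map_dvd _ (map_dvd _ (Finset.dvd_prod_of_mem (fun i => ratDen (φ i)) (Finset.mem_univ i))))
    (IsLocalization.Away.algebraMap_isUnit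
      (Ideal.Quotient.mk (vanishingIdeal ℝ Y) (commonDen φ)))

variable (Y φ) in
/-- Composition of polynomial functions with a rational map. -/
noncomputable def pullback : MvPolynomial (Fin m) ℝ →ₐ[ℝ] DomainRing Y φ :=
  aeval fun i => algebraMap _ _ (Ideal.Quotient.mk (vanishingIdeal ℝ Y) (ratNum (φ i))) *
    ((isUnit_algebraMap_ratDen (Y := Y) (φ := φ) i).unit⁻¹ : (DomainRing Y φ)ˣ)

theorem domainEval_pullback {y : Fin p → ℝ} (hy : y ∈ Y ∩ φ.domain)
    (P : MvPolynomial (Fin m) ℝ) :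
    domainEval hy (pullback Y φ P) = eval (φ.toFun y) P := by
  have hX (i : Fin m) : domainEval hy (pullback Y φ (X i)) = φ.toFun y i := by
    have hden : eval y (ratDen (φ i)) ≠ 0 := isDefinedAt_iff.mp (hy.2 i)
    rw [RationalMap.toFun, value_eq (isRepresentationAt_ratNum_ratDen hden), eq_div_iff hden,
      ← evalAt_mk hy.1 (ratDen _), ← domainEval_algebraMap hy, ← map_mul, pullback, aeval_X,
      mul_assoc, IsUnit.val_inv_mul, mul_one, domainEval_algebraMap, evalAt_mk]
  have heval := ringHom_eq_eval ((domainEval hy).comp (pullback Y φ).toRingHom)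
  exact (RingHom.congr_fun heval P).trans (by congr 2; exact funext hX)

/-- The pullback of regular functions along a rational map `Y ⇢ Z`. -/
noncomputable def comorphism (h : Set.MapsTo φ.toFun (Y ∩ φ.domain) Z) :
    CoordRing Z →ₐ[ℝ] DomainRing Y φ :=
  Ideal.Quotient.liftₐ _ (pullback Y φ) fun P hP =>
    eq_zero_of_forall_domainEval_eq_zero fun y hy => by
      rw [domainEval_pullback, ← aeval_eq_eval]
      exact hP _ (h hy)

theorem domainEval_comorphism (h : Set.MapsTo φ.toFun (Y ∩ φ.domain) Z) {y : Fin p → ℝ}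
    (hy : y ∈ Y ∩ φ.domain) (c : CoordRing Z) :
    domainEval hy (comorphism h c) = evalAt (h hy) c := by
  obtain ⟨P, rfl⟩ := Ideal.Quotient.mk_surjective c
  rw [evalAt_mk]
  exact domainEval_pullback hy P

theorem domainEval_comp_comorphism_eq_evalAt_iff (h : Set.MapsTo φ.toFun (Y ∩ φ.domain) Z)
    {y : Fin p → ℝ} (hy : y ∈ Y ∩ φ.domain) {z : Fin m → ℝ} (hz : z ∈ Z) :
    (domainEval hy).comp (comorphism h).toRingHom = evalAt hz ↔ φ.toFun y = z := by
  have hcomp : (domainEval hy).comp (comorphism h).toRingHom = evalAt (h hy) :=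
    RingHom.ext (domainEval_comorphism h hy)
  rw [hcomp]
  refine ⟨fun heq => funext fun i => ?_, fun heq => by subst heq; rfl⟩
  simpa using RingHom.congr_fun heq (Ideal.Quotient.mk _ (X i))

theorem ncard_fiber_eq (hY : IsAlgebraicSet Y) (h : Set.MapsTo φ.toFun (Y ∩ φ.domain) Z)
    {z : Fin m → ℝ} (hz : z ∈ Z) :
    {y ∈ Y ∩ φ.domain | φ.toFun y = z}.ncard =
      {γ : DomainRing Y φ →+* ℝ | γ.comp (comorphism h).toRingHom = evalAt hz}.ncard := by
  have hfiber {y : Fin p → ℝ} (hy : y ∈ Y ∩ φ.domain) :=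
    domainEval_comp_comorphism_eq_evalAt_iff h hy hz
  refine Set.ncard_congr (fun y hy => domainEval hy.1) (fun y hy => (hfiber hy.1).mpr hy.2)
    (fun y y' hy hy' => domainEval_injective hy.1 hy'.1) fun γ hγ => ?_
  obtain ⟨y, hy, rfl⟩ := exists_domainEval_eq hY γ
  exact ⟨y, ⟨hy, (hfiber hy).mp hγ⟩, rfl⟩

theorem comorphism_injective (h : Set.MapsTo φ.toFun (Y ∩ φ.domain) Z)
    (hdense : vanishingIdeal ℝ (φ.toFun '' (Y ∩ φ.domain)) = vanishingIdeal ℝ Z) :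
    Function.Injective (comorphism h) := by
  refine (injective_iff_map_eq_zero _).mpr fun c hc => ?_
  by_contra hne
  obtain ⟨-, ⟨y, hy, rfl⟩, hyc⟩ := exists_evalAt_ne_zero h.image_subset hdense hne
  exact hyc (by rw [← domainEval_comorphism h hy, hc, map_zero])

theorem mk_commonDen_ne_zero (hne : (Y ∩ φ.domain).Nonempty) :
    Ideal.Quotient.mk (vanishingIdeal ℝ Y) (commonDen φ) ≠ 0 := by
  obtain ⟨y, hy, hyφ⟩ := hne
  intro h
  exact mem_domain_iff.mp hyφ (by rw [← evalAt_mk hy, h, map_zero])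

theorem trdeg_domainRing [IsDomain (CoordRing Y)] [IsDomain (DomainRing Y φ)] {d : ℕ}
    (hne : (Y ∩ φ.domain).Nonempty) (hYd : dim Y = d) : Algebra.trdeg ℝ (DomainRing Y φ) = d := by
  set g := Ideal.Quotient.mk (vanishingIdeal ℝ Y) (commonDen φ)
  have hle := powers_le_nonZeroDivisors_of_noZeroDivisors (mk_commonDen_ne_zero hne)
  have : FaithfulSMul (CoordRing Y) (DomainRing Y φ) :=
    (faithfulSMul_iff_algebraMap_injective _ _).mpr (IsLocalization.injective _ hle)
  have : Algebra.IsAlgebraic (CoordRing Y) (DomainRing Y φ) :=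
    IsLocalization.isAlgebraic _ (Submonoid.powers g)
  rw [trdeg_eq_of_isAlgebraic ℝ (CoordRing Y) (DomainRing Y φ)]
  exact trdeg_eq_of_ringKrullDim_eq ℝ (CoordRing Y) hYd

theorem finiteType_domainRing : Algebra.FiniteType ℝ (DomainRing Y φ) :=
  have : Algebra.FiniteType (CoordRing Y) (DomainRing Y φ) :=
    IsLocalization.finiteType_of_monoid_fg (Submonoid.powers
      (Ideal.Quotient.mk (vanishingIdeal ℝ Y) (commonDen φ))) _
  .trans (S := CoordRing Y) inferInstance inferInstance

theorem nonempty_of_vanishingIdeal_image_eq (hZ : IsIrreducibleAlgebraicSet Z)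
    (hdense : vanishingIdeal ℝ (φ.toFun '' (Y ∩ φ.domain)) = vanishingIdeal ℝ Z) :
    (Y ∩ φ.domain).Nonempty := by
  by_contra hempty
  rw [Set.not_nonempty_iff_eq_empty.mp hempty, Set.image_empty, vanishingIdeal_empty] at hdense
  exact hZ.isPrime.ne_top hdense.symm

theorem exists_forall_ncard_fiber_modEq {d : ℕ} (hZ : IsIrreducibleAlgebraicSet Z)
    (hZd : dim Z = d) (hY : IsIrreducibleAlgebraicSet Y) (hYd : dim Y = d)
    (hmaps : Set.MapsTo φ.toFun (Y ∩ φ.domain) Z)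
    (hdense : vanishingIdeal ℝ (φ.toFun '' (Y ∩ φ.domain)) = vanishingIdeal ℝ Z) :
    ∃ (a : CoordRing Z) (k : ℕ), a ≠ 0 ∧ ∀ (z : Fin m → ℝ) (hz : z ∈ Z), evalAt hz a ≠ 0 →
      {y ∈ Y ∩ φ.domain | φ.toFun y = z}.ncard ≡ k [MOD 2] := by
  have := hZ.isPrime
  have := hY.isPrime
  have hne := nonempty_of_vanishingIdeal_image_eq hZ hdense
  have : IsDomain (DomainRing Y φ) := IsLocalization.isDomain_localization
    (powers_le_nonZeroDivisors_of_noZeroDivisors (mk_commonDen_ne_zero hne))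
  let := (comorphism hmaps).toRingHom.toAlgebra
  have : FaithfulSMul (CoordRing Z) (DomainRing Y φ) :=
    (faithfulSMul_iff_algebraMap_injective _ _).mpr (comorphism_injective hmaps hdense)
  have : IsScalarTower ℝ (CoordRing Z) (DomainRing Y φ) :=
    .of_algebraMap_eq fun x => ((comorphism hmaps).commutes x).symm
  have := finiteType_domainRing (Y := Y) (φ := φ)
  have : Algebra.FiniteType (CoordRing Z) (DomainRing Y φ) := .of_restrictScalars_finiteType ℝ _ _
  have : Algebra.IsAlgebraic (CoordRing Z) (DomainRing Y φ) :=
    isAlgebraic_of_trdeg_eq (trdeg_eq_of_ringKrullDim_eq ℝ (CoordRing Z) hZd)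
      (trdeg_domainRing hne hYd)
  have : CharZero (CoordRing Z) := algebraRat.charZero _
  obtain ⟨a, k, ha, hk⟩ := exists_forall_ncard_modEq (CoordRing Z) (DomainRing Y φ)
  exact ⟨a, k, ha, fun z hz hza => ncard_fiber_eq hY.isAlgebraic hmaps hz ▸ hk _ hza⟩

theorem inter_image_nonempty_of_injOn {d : ℕ} {N : Set (Fin m → ℝ)}
    (hZ : IsIrreducibleAlgebraicSet Z) (hZd : dim Z = d) (hY : IsIrreducibleAlgebraicSet Y)
    (hYd : dim Y = d) (hmaps : Set.MapsTo φ.toFun (Y ∩ φ.domain) Z)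
    (hdense : vanishingIdeal ℝ (φ.toFun '' (Y ∩ φ.domain)) = vanishingIdeal ℝ Z)
    (hinj : Set.InjOn φ.toFun (Y ∩ φ.domain)) (hNZ : N ⊆ Z)
    (hN : vanishingIdeal ℝ N = vanishingIdeal ℝ Z) :
    (N ∩ φ.toFun '' (Y ∩ φ.domain)).Nonempty := by
  obtain ⟨a, k, ha, hk⟩ := exists_forall_ncard_fiber_modEq hZ hZd hY hYd hmaps hdense
  obtain ⟨-, ⟨y, hy, rfl⟩, hya⟩ := exists_evalAt_ne_zero hmaps.image_subset hdense ha
  obtain ⟨w, hw, hwa⟩ := exists_evalAt_ne_zero hNZ hN ha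
  have hsingleton : {y' ∈ Y ∩ φ.domain | φ.toFun y' = φ.toFun y} = {y} :=
    Set.eq_singleton_iff_unique_mem.mpr ⟨⟨hy, rfl⟩, fun y' hy' => hinj hy'.1 hy hy'.2⟩
  have hk1 := hk _ (hmaps hy) hya
  rw [hsingleton, Set.ncard_singleton] at hk1
  have hodd := (hk w (hNZ hw) hwa).trans hk1.symm
  obtain ⟨x, hx, hxw⟩ : {x ∈ Y ∩ φ.domain | φ.toFun x = w}.Nonempty :=
    Set.nonempty_of_ncard_ne_zero fun h0 => absurd (h0 ▸ hodd) (by decide)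
  exact ⟨w, hw, x, hx, hxw⟩

end RationalMap

theorem IsConnectedComponentOf.subset {n : ℕ} {M Z : Set (Fin n → ℝ)}
    (hM : IsConnectedComponentOf M Z) : M ⊆ Z := by
  obtain ⟨x, -, rfl⟩ := hM
  exact connectedComponentIn_subset Z x

theorem IsConnectedComponentOf.eq_of_inter_nonempty {n : ℕ} {M N Z : Set (Fin n → ℝ)}
    (hM : IsConnectedComponentOf M Z) (hN : IsConnectedComponentOf N Z) (h : (N ∩ M).Nonempty) :
    N = M := by
  obtain ⟨x, -, rfl⟩ := hM
  obtain ⟨y, -, rfl⟩ := hN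
  obtain ⟨z, hzy, hzx⟩ := h
  rw [connectedComponentIn_eq hzy, connectedComponentIn_eq hzx]

theorem IsConnectedComponentOf.dim_eq_of_forall_dim_le {n : ℕ} {M Z : Set (Fin n → ℝ)}
    (hM : IsConnectedComponentOf M Z) (hZ : IsIrreducibleAlgebraicSet Z)
    (hmax : ∀ N, IsConnectedComponentOf N Z → dim N ≤ dim M) : dim M = dim Z := by
  obtain ⟨C, hC, hCZ⟩ := exists_isConnectedComponentOf_vanishingIdeal_eq hZ
  have hCd : dim C = dim Z := by rw [dim, dim, hCZ]
  exact le_antisymm (dim_mono hM.subset) (hCd ▸ hmax C hC)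

end RealAlg

theorem lemma6p2_general {m p d : ℕ} (Z M : Set (Fin m → ℝ)) (Y : Set (Fin p → ℝ))
    (φ : RealAlg.RationalMap p m)
    (hZirr : RealAlg.IsIrreducibleAlgebraicSet Z)
    (hM : RealAlg.IsConnectedComponentOf M Z)
    (hMd : RealAlg.dim M = d)
    (hMmax : ∀ N : Set (Fin m → ℝ), RealAlg.IsConnectedComponentOf N Z →
      RealAlg.dim N ≤ RealAlg.dim M)
    (hY : RealAlg.IsIrreducibleAlgebraicSet Y)
    (hYd : RealAlg.dim Y = d)
    (hφ : Set.BijOn (RealAlg.RationalMap.toFun φ) (Y ∩ RealAlg.RationalMap.domain φ) M) :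
    ∀ N : Set (Fin m → ℝ), RealAlg.IsConnectedComponentOf N Z → RealAlg.dim N = d → N = M := by
  intro N hN hNd
  have hZd : RealAlg.dim Z = d := (hM.dim_eq_of_forall_dim_le hZirr hMmax).symm.trans hMd
  have hMdense := RealAlg.vanishingIdeal_eq_of_dim_eq hZirr hM.subset hMd hZd
  have hNdense := RealAlg.vanishingIdeal_eq_of_dim_eq hZirr hN.subset hNd hZd
  have hmeet := RealAlg.inter_image_nonempty_of_injOn hZirr hZd hY hYd
    (hφ.mapsTo.mono_right hM.subset) (by rwa [hφ.image_eq]) hφ.injOn hN.subset hNdense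
  rw [hφ.image_eq] at hmeet
  exact hM.eq_of_inter_nonempty hN hmeet

theorem lemma6p2 {m p d : ℕ} (Z M : Set (Fin m → ℝ)) (Y : Set (Fin p → ℝ))
    (φ : RealAlg.RationalMap p m)
    (hZirr : RealAlg.IsIrreducibleAlgebraicSet Z)
    (hZns : RealAlg.IsNonsingular Z)
    (hM : RealAlg.IsConnectedComponentOf M Z)
    (hMd : RealAlg.dim M = d)
    (hMmax : ∀ N : Set (Fin m → ℝ), RealAlg.IsConnectedComponentOf N Z →
      RealAlg.dim N ≤ RealAlg.dim M)
    (hY : RealAlg.IsIrreducibleAlgebraicSet Y)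
    (hYd : RealAlg.dim Y = d)
    (hφ : Set.BijOn (RealAlg.RationalMap.toFun φ) (Y ∩ RealAlg.RationalMap.domain φ) M) :
    ∀ N : Set (Fin m → ℝ), RealAlg.IsConnectedComponentOf N Z → RealAlg.dim N = d → N = M :=
  lemma6p2_general Z M Y φ hZirr hM hMd hMmax hY hYd hφ
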